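/- Consider the HLV model: $n$ camera locations $t_1^*,\dots,t_n^*$ are drawn i.i.d. from $N(0,I)$ in $\mathbb{R}^3$; independently of them, a graph $G([n],E)$ is drawn from the Erdős–Rényi ensemble $G(n,p)$; a set $E_b\subseteq E$ of bad edges whose maximal degree is at most $n\epsilon_b$ is chosen arbitrarily; each edge $ij\in E\setminus E_b$ carries its true direction $\gamma_{ij}=\gamma_{ij}^*:=(t_i^*-t_j^*)/\|t_i^*-t_j^*\|$, and each bad edge an arbitrary direction $\gamma_{ij}\in S^2$. The graph $G([n],E)$ with vertex locations $t_1^*,\dots,t_n^*$ is called parallel rigid in $\mathbb{R}^3$ if the locations are distinct and are determined, up to scale and shift, by the edge directions: whenever $t_1',\dots,t_n'\in\mathbb{R}^3$ satisfy $(t_i'-t_j')/\|t_i'-t_j'\|=\gamma_{ij}^*$ for all $ij\in E$, there are $c>0$ and $s\in\mathbb{R}^3$ with $t_i'=ct_i^*+s$ for all $i$. **Proposition.** A graph generated by the HLV model with $p\gtrsim n^{-1/3}\log^{1/3}n$ and $\epsilon_b\lesssim p^{7/3}/\log^{9/2}n$ is parallel rigid in $\mathbb{R}^3$ with overwhelming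 probability. Precisely: there are absolute constants $\alpha,C>0$ such that for all $C_0,C_1>0$ there is $n_0$ such that for all $n>n_0$, all $p$ with $C_0n^{-1/3}\log^{1/3}n\le p\le 1$ and all $\epsilon_b\le C_1p^{7/3}/\log^{9/2}n$, the graph $G([n],E)$ with locations $t_1^*,\dots,t_n^*$ generated by the HLV model with parameters $n,p,\epsilon_b$ is parallel rigid in $\mathbb{R}^3$ with probability at least $1-e^{-Cn^{\alpha}}$. -/

import Mathlib

open MeasureTheory ProbabilityTheory
open scoped unitInterval

noncomputable section

/-- Euclidean space `ℝ³`. -/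
abbrev E3 : Type := EuclideanSpace ℝ (Fin 3)

/-- The direction from `y` to `x`: the unit vector `(x - y) / ‖x - y‖` (for `x ≠ y`). -/
def direction (x y : E3) : E3 := ‖x - y‖⁻¹ • (x - y)

/-- The graph `G` with vertex locations `t` is parallel rigid in `ℝ³`: the locations are distinct,
and they are the only ones, up to scale and shift, that have the same edge directions.
(A competitor `t'` is automatically noncoincident along the edges, since its edge directions are
required to equal unit vectors.) -/
def IsParallelRigid {n : ℕ} (G : SimpleGraph (Fin n)) (t : Fin n → E3) : Prop :=
  Function.Injective t ∧
    ∀ t' : Fin n → E3,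
      (∀ i j, G.Adj i j → direction (t' i) (t' j) = direction (t i) (t j)) →
        ∃ c : ℝ, 0 < c ∧ ∃ s : E3, ∀ i, t' i = c • t i + s

open scoped Classical in
/-- The corruption level of a set of bad edges (given as a graph on the cameras): the maximal degree
of the bad edges, divided by the number of cameras. -/
def corruptionLevel {n : ℕ} (B : SimpleGraph (Fin n)) : ℝ := (B.maxDegree : ℝ) / n

/-- The HLV model with parameters `n`, `p` and `εb`: random camera locations `t`, a random graph `G`
on the cameras, the random set of bad (corrupted) edges `B`, and random pairwise directions `γ`.
Edges are undirected, and `γ ω i j` is the direction attached to the edge `ij` when it is read from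
`j` to `i`. The bad edges and their directions are arbitrary: they may depend on everything else. -/
structure IsHLVModel {Ω : Type*} [MeasurableSpace Ω] (P : Measure Ω) (n : ℕ) (p : I) (εb : ℝ)
    (t : Fin n → Ω → E3) (G B : Ω → SimpleGraph (Fin n)) (γ : Ω → Fin n → Fin n → E3) : Prop where
  /-- Each location has law `N(0, I)`. -/
  location_law : ∀ i, HasLaw (t i) (stdGaussian E3) P
  /-- The locations are independent. -/
  location_indep : iIndepFun t P
  /-- The graph is an Erdős–Rényi graph `G(n, p)`. -/
  graph_law : HasLaw G (SimpleGraph.binomialRandom (Fin n) p) P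
  /-- The graph is drawn independently of the locations. -/
  graph_indep : IndepFun (fun ω i => t i ω) G P
  /-- The bad edges are edges. -/
  bad_le : ∀ ω, B ω ≤ G ω
  /-- The corruption level is at most `εb`. -/
  corruption_le : ∀ᵐ ω ∂P, corruptionLevel (B ω) ≤ εb
  /-- A good edge carries its true direction. -/
  good_direction : ∀ ω i j, (G ω).Adj i j → ¬ (B ω).Adj i j → γ ω i j = direction (t i ω) (t j ω)
  /-- A bad edge carries an arbitrary unit vector. -/
  bad_direction : ∀ ω i j, (B ω).Adj i j → ‖γ ω i j‖ = 1
  /-- There is one direction per undirected edge: reading the edge backwards changes the sign. -/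
  direction_symm : ∀ ω i j, (G ω).Adj i j → γ ω j i = -γ ω i j

end

/-! A competitor `t'` stretches each edge by a positive factor. A nondegenerate triangle forces its
three factors to agree, since its sides satisfy only one linear relation
(`eq_of_smul_sub_triangle`). If the link of every vertex is connected by short paths, all factors at
a vertex agree; as any two vertices have a common neighbour, the factor is global and `t'` is a
scaled translate of `t` (`HasLinkPaths.isParallelRigid`).

Gaussian points are almost surely in general position, so only the graph condition costs
probability. For a triple `v, u, w`, reserve disjoint vertex sets `U` and `W`. With high probability
`v, u` have `k` common neighbours in `U` and `v, w` have `k` in `W`. The edges between `U` and `W`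
are independent of this, so the `k * k` candidate edges are all absent with probability at most `(1
- p) ^ (k * k)`. A union bound over triples finishes. -/

/-! ### Deterministic criterion for parallel rigidity -/

/-- Any two edges at a vertex `v` are joined by a path of length three in the link of `v`. -/
def HasLinkPaths {V : Type*} (G : SimpleGraph V) : Prop :=
  ∀ v u w, v ≠ u → v ≠ w → u ≠ w →
    ∃ x y, G.Adj v x ∧ G.Adj u x ∧ G.Adj v y ∧ G.Adj w y ∧ G.Adj x y

/-- No three of the points are collinear. -/
def InGeneralPosition {V : Type*} (t : V → E3) : Prop :=
  ∀ i j k, i ≠ j → i ≠ k → j ≠ k → LinearIndependent ℝ ![t i - t j, t i - t k]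

theorem exists_pos_smul_of_direction_eq {a b c d : E3} (hab : a ≠ b)
    (h : direction c d = direction a b) : ∃ r : ℝ, 0 < r ∧ c - d = r • (a - b) := by
  have hab' : 0 < ‖a - b‖ := norm_pos_iff.2 (sub_ne_zero.2 hab)
  unfold direction at h
  -- Coincident points have `direction` zero, since `0⁻¹ = 0`.
  have hcd : 0 < ‖c - d‖ := by
    rw [norm_pos_iff]
    intro h0
    rw [h0, smul_zero] at h
    exact (smul_ne_zero (inv_ne_zero hab'.ne') (sub_ne_zero.2 hab)) h.symm
  refine ⟨‖c - d‖ * ‖a - b‖⁻¹, by positivity, ?_⟩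
  rw [mul_smul, ← h, smul_smul, mul_inv_cancel₀ hcd.ne', one_smul]

theorem eq_of_smul_sub_triangle {a b c a' b' c' : E3} {r s q : ℝ}
    (hli : LinearIndependent ℝ ![a - b, a - c]) (hr : a' - b' = r • (a - b))
    (hs : a' - c' = s • (a - c)) (hq : b' - c' = q • (b - c)) : r = s := by
  have h : (r - q) • (a - b) + (q - s) • (a - c) = 0 := by
    have : (a' - b') - (a' - c') + (b' - c') = 0 := by abel
    rw [hr, hs, hq] at this
    rw [← this]
    module
  obtain ⟨h1, h2⟩ := LinearIndependent.pair_iff.1 hli _ _ h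
  linarith

theorem HasLinkPaths.isParallelRigid {n : ℕ} (hn : 3 ≤ n) {G : SimpleGraph (Fin n)}
    {t : Fin n → E3} (hG : HasLinkPaths G) (ht : InGeneralPosition t) : IsParallelRigid G t := by
  have third : ∀ a b : Fin n, ∃ c, c ≠ a ∧ c ≠ b := fun a b => by
    have : ({a, b} : Finset (Fin n)).card < Fintype.card (Fin n) :=
      lt_of_le_of_lt Finset.card_le_two (by simpa using Nat.lt_of_succ_le hn)
    obtain ⟨c, hc⟩ := Finset.exists_mem_notMem_of_card_lt_card
      (s := {a, b}) (t := Finset.univ) (by simpa using this)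
    exact ⟨c, by simp_all⟩
  have hinj : Function.Injective t := by
    intro a b hab
    by_contra hne
    obtain ⟨c, hca, hcb⟩ := third a b
    have := (ht a b c hne hca.symm hcb.symm).ne_zero 0
    simp [hab] at this
  refine ⟨hinj, fun t' h' => ?_⟩
  have common : ∀ a b, a ≠ b → ∃ z, G.Adj a z ∧ G.Adj b z := fun a b hab => by
    obtain ⟨c, hca, hcb⟩ := third a b
    obtain ⟨x, _, h1, h2, _⟩ := hG a b c hab hca.symm hcb.symm
    exact ⟨x, h1, h2⟩
  -- Putting adjacency under the existential gives a total function `r`; its values off the edges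
  -- are junk.
  have hpos : ∀ i j, ∃ r : ℝ, G.Adj i j → 0 < r ∧ t' i - t' j = r • (t i - t j) := fun i j => by
    by_cases hij : G.Adj i j
    · obtain ⟨r, hr⟩ := exists_pos_smul_of_direction_eq (hinj.ne hij.ne) (h' i j hij)
      exact ⟨r, fun _ => hr⟩
    · exact ⟨0, fun h => absurd h hij⟩
  choose r hr using hpos
  have tri : ∀ v x y, G.Adj v x → G.Adj v y → G.Adj x y → r v x = r v y := fun v x y h1 h2 h3 =>
    eq_of_smul_sub_triangle (ht v x y h1.ne h2.ne h3.ne) (hr v x h1).2 (hr v y h2).2 (hr x y h3).2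
  have star : ∀ v u w, G.Adj v u → G.Adj v w → r v u = r v w := fun v u w hu hw => by
    by_cases huw : u = w
    · rw [huw]
    obtain ⟨x, y, hvx, hux, hvy, hwy, hxy⟩ := hG v u w hu.ne hw.ne huw
    -- The link path `u, x, y, w` spans three triangles at `v`, consecutive ones sharing an edge.
    exact (tri v u x hu hvx hux).trans ((tri v x y hvx hvy hxy).trans (tri v w y hw hvy hwy).symm)
  have symm : ∀ i j, G.Adj i j → r i j = r j i := fun i j hij => by
    have h1 := (hr i j hij).2
    have h2 := (hr j i hij.symm).2
    have h3 : (r i j - r j i) • (t i - t j) = 0 := by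
      rw [sub_smul, ← h1, ← neg_sub (t j), smul_neg, ← h2]
      abel
    exact sub_eq_zero.1 ((smul_eq_zero.1 h3).resolve_right (sub_ne_zero.2 (hinj.ne hij.ne)))
  have const : ∀ a z b w, G.Adj a z → G.Adj b w → r a z = r b w := fun a z b w haz hbw => by
    by_cases hab : a = b
    · subst hab
      exact star a z w haz hbw
    obtain ⟨y, hay, hby⟩ := common a b hab
    rw [star a z y haz hay, symm a y hay, star y a b hay.symm hby.symm, ← symm b y hby,
      star b y w hby hbw]
  let o : Fin n := ⟨0, by omega⟩
  obtain ⟨o', ho', -⟩ := third o o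
  obtain ⟨z, hoz, -⟩ := common o o' ho'.symm
  refine ⟨r o z, (hr o z hoz).1, t' o - r o z • t o, fun i => ?_⟩
  by_cases hi : i = o
  · subst hi
    abel
  obtain ⟨y, hiy, hoy⟩ := common i o hi
  have h1 := (hr i y hiy).2
  have h2 := (hr o y hoy).2
  rw [const i y o z hiy hoz] at h1
  rw [star o y z hoy hoz] at h2
  have h3 : t' i = t' o + (r o z • (t i - t y) - r o z • (t o - t y)) := by
    rw [← h1, ← h2]
    abel
  rw [h3]
  module

/-! ### Gaussian points are almost surely in general position -/

/-- A nonzero functional pushes the Gaussian to a real Gaussian of positive variance, which has no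
atoms. -/
theorem stdGaussian_hyperplane_eq_zero (L : StrongDual ℝ E3) (hL : L ≠ 0) (c : ℝ) :
    stdGaussian E3 {x | L x = c} = 0 := by
  have h : (stdGaussian E3).map L {c} = 0 := by
    have : NullSingletonClass ((stdGaussian E3).map L) := by
      rw [IsGaussian.map_eq_gaussianReal L]
      refine nullSingletonClass_gaussianReal ?_
      rw [variance_dual_stdGaussian, ne_eq, Real.toNNReal_eq_zero, not_le]
      have := norm_pos_iff.2 hL
      positivity
    exact measure_singleton c
  rwa [Measure.map_apply (by fun_prop) (measurableSet_singleton c)] at h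

/-- The third coordinate of the cross product of `a - b` and `a - c`. -/
noncomputable def planarDet (a b c : E3) : ℝ :=
  (a - b) 0 * (a - c) 1 - (a - b) 1 * (a - c) 0

theorem linearIndependent_of_planarDet_ne_zero {a b c : E3} (h : planarDet a b c ≠ 0) :
    LinearIndependent ℝ ![a - b, a - c] := by
  rw [LinearIndependent.pair_iff]
  intro r s hrs
  have h0 : r * (a - b) 0 + s * (a - c) 0 = 0 := by simpa using congrArg (fun x : E3 => x 0) hrs
  have h1 : r * (a - b) 1 + s * (a - c) 1 = 0 := by simpa using congrArg (fun x : E3 => x 1) hrs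
  have hr : r * planarDet a b c = 0 := by
    unfold planarDet
    linear_combination (a - c) 1 * h0 - (a - c) 0 * h1
  have hs : s * planarDet a b c = 0 := by
    unfold planarDet
    linear_combination (a - b) 0 * h1 - (a - b) 1 * h0
  exact ⟨(mul_eq_zero.1 hr).resolve_right h, (mul_eq_zero.1 hs).resolve_right h⟩

/-- As a function of `c`, the determinant is affine with nonzero linear part, so its zero set is a
hyperplane. -/
theorem stdGaussian_planarDet_eq_zero {a b : E3} (hab : (a - b) 0 ≠ 0) :
    stdGaussian E3 {c | planarDet a b c = 0} = 0 := by
  let L : StrongDual ℝ E3 :=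
    (a - b) 0 • EuclideanSpace.proj (1 : Fin 3) - (a - b) 1 • EuclideanSpace.proj (0 : Fin 3)
  have hL : L ≠ 0 := by
    intro h
    apply hab
    simpa [L] using congrArg (fun M : StrongDual ℝ E3 => M (EuclideanSpace.single 1 1)) h
  convert stdGaussian_hyperplane_eq_zero L hL (L a) using 2
  ext c
  have hLx : ∀ x, L x = (a - b) 0 * x 1 - (a - b) 1 * x 0 := fun x => rfl
  simp only [planarDet, Set.mem_ofPred_eq, hLx, PiLp.sub_apply]
  constructor <;> intro h <;> linarith

theorem stdGaussian_prod_coord_eq :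
    ((stdGaussian E3).prod (stdGaussian E3)) {x | (x.1 - x.2) 0 = 0} = 0 := by
  have hm : MeasurableSet {x : E3 × E3 | (x.1 - x.2) 0 = 0} :=
    (isClosed_eq (by fun_prop) continuous_const).measurableSet
  rw [Measure.measure_prod_null hm]
  refine Filter.Eventually.of_forall fun a => ?_
  have hL : (EuclideanSpace.proj (0 : Fin 3) : StrongDual ℝ E3) ≠ 0 := by
    intro h
    simpa using congrArg (fun M : StrongDual ℝ E3 => M (EuclideanSpace.single 0 1)) h
  refine measure_mono_null (fun c hc => ?_) (stdGaussian_hyperplane_eq_zero _ hL (a 0))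
  have : a 0 - c 0 = 0 := by simpa using hc
  simpa using (sub_eq_zero.1 this).symm

theorem stdGaussian_prod_planarDet_eq_zero :
    (((stdGaussian E3).prod (stdGaussian E3)).prod (stdGaussian E3))
      {x | planarDet x.1.1 x.1.2 x.2 = 0} = 0 := by
  have hm : MeasurableSet {x : (E3 × E3) × E3 | planarDet x.1.1 x.1.2 x.2 = 0} :=
    (isClosed_eq (by unfold planarDet; fun_prop) continuous_const).measurableSet
  rw [Measure.measure_prod_null hm]
  have h0 : ∀ᵐ x ∂((stdGaussian E3).prod (stdGaussian E3)), (x.1 - x.2) 0 ≠ 0 :=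
    measure_eq_zero_iff_ae_notMem.1 stdGaussian_prod_coord_eq
  filter_upwards [h0] with x hx
  exact stdGaussian_planarDet_eq_zero hx

theorem ae_inGeneralPosition {Ω V : Type*} [MeasurableSpace Ω] {P : Measure Ω}
    [IsProbabilityMeasure P] [Countable V] {t : V → Ω → E3}
    (hlaw : ∀ i, HasLaw (t i) (stdGaussian E3) P) (hindep : iIndepFun t P) :
    ∀ᵐ ω ∂P, InGeneralPosition fun i => t i ω := by
  have key : ∀ i j k, i ≠ j → i ≠ k → j ≠ k →
      ∀ᵐ ω ∂P, planarDet (t i ω) (t j ω) (t k ω) ≠ 0 := by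
    intro i j k hij hik hjk
    have hm := fun i => (hlaw i).aemeasurable
    have h1 := (hindep.indepFun hij).map_prod_eq_prod_map_map (hm i) (hm j)
    have h2 := (hindep.indepFun_prodMk₀ hm i j k hik hjk).map_prod_eq_prod_map_map
      ((hm i).prodMk (hm j)) (hm k)
    rw [h1, (hlaw i).map_eq, (hlaw j).map_eq, (hlaw k).map_eq] at h2
    have h3 := measure_eq_zero_iff_ae_notMem.1 stdGaussian_prod_planarDet_eq_zero
    rw [← h2] at h3
    exact ae_of_ae_map (((hm i).prodMk (hm j)).prodMk (hm k)) h3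
  have : ∀ᵐ ω ∂P, ∀ i j k, i ≠ j → i ≠ k → j ≠ k →
      planarDet (t i ω) (t j ω) (t k ω) ≠ 0 := by
    simp only [ae_all_iff]
    exact key
  filter_upwards [this] with ω hω i j k hij hik hjk
  exact linearIndependent_of_planarDet_ne_zero (hω i j k hij hik hjk)

/-! ### Independence of events depending on disjoint coordinates -/

section Independence

variable {ι : Type*} [Finite ι] {ν : ι → Measure Prop} [∀ i, IsProbabilityMeasure (ν i)]

theorem infinitePi_real_and_of_dependsOn {S T : Set ι} (hST : Disjoint S T)
    {A B : (ι → Prop) → Prop} (hA : DependsOn A S) (hB : DependsOn B T) :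
    (Measure.infinitePi ν).real {ω | A ω ∧ B ω} =
      (Measure.infinitePi ν).real {ω | A ω} * (Measure.infinitePi ν).real {ω | B ω} := by
  classical
  have hind : iIndepFun (fun i (ω : ι → Prop) => ω i) (Measure.infinitePi ν) :=
    iIndepFun_infinitePi (X := fun _ a => a) fun _ => measurable_id
  have hS := S.toFinite
  have hT := T.toFinite
  have h := hind.indepFun_finset hS.toFinset hT.toFinset (by simpa using hST)
    fun i => measurable_pi_apply i
  -- Extending a partial configuration by `False` outside `U` is harmless, since `F` ignores those
  -- coordinates.
  have factor : ∀ {U : Set ι} {F : (ι → Prop) → Prop} (hU : U.Finite), DependsOn F U →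
      ∃ f : ((i : hU.toFinset) → Prop) → Prop, ∀ ω, F ω = f fun i => ω i := fun {U F} hU hF =>
    ⟨fun x => F fun i => if hi : i ∈ hU.toFinset then x ⟨i, hi⟩ else False, fun ω => hF fun i hi => by
      simp [hi]⟩
  obtain ⟨f, hf⟩ := factor hS hA
  obtain ⟨g, hg⟩ := factor hT hB
  have h2 := h.measure_inter_preimage_eq_mul {x | f x} {x | g x}
    (Set.toFinite _).measurableSet (Set.toFinite _).measurableSet
  simp only [hf, hg, measureReal_def, ← ENNReal.toReal_mul]
  exact congrArg ENNReal.toReal h2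

theorem infinitePi_real_forall_of_dependsOn {κ : Type*} [DecidableEq κ] (J : Finset κ) {S : κ → Set ι}
    {A : κ → (ι → Prop) → Prop} (hS : (J : Set κ).PairwiseDisjoint S)
    (hA : ∀ j ∈ J, DependsOn (A j) (S j)) :
    (Measure.infinitePi ν).real {ω | ∀ j ∈ J, A j ω} =
      ∏ j ∈ J, (Measure.infinitePi ν).real {ω | A j ω} := by
  induction J using Finset.induction_on with
  | empty => simp
  | insert a J ha ih =>
    rw [Finset.prod_insert ha, ← ih (hS.subset (by simp)) fun j hj => hA j (by simp [hj])]
    simp only [Finset.forall_mem_insert]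
    refine infinitePi_real_and_of_dependsOn (T := ⋃ j ∈ J, S j) ?_ (hA a (by simp)) ?_
    · rw [Set.disjoint_iUnion₂_right]
      intro j hj
      exact hS (by simp) (by simp [hj]) fun h => ha (h ▸ hj)
    · intro x y hxy
      refine propext (forall₂_congr fun j hj => ?_)
      rw [hA j (by simp [hj]) fun i hi => hxy i (by simp only [Set.mem_iUnion]; exact ⟨j, hj, hi⟩)]

/-- Conditioning on the value `x` of `g` leaves `N x` independent, so a bound uniform in `x`
survives averaging. -/
theorem infinitePi_real_le_of_dependsOn {κ : Type*} [Finite κ] {S T : Set ι} (hST : Disjoint S T)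
    {g : (ι → Prop) → κ} {K : κ → Prop} {N : κ → (ι → Prop) → Prop} (hg : DependsOn g S)
    (hN : ∀ x, K x → DependsOn (N x) T) {δ : ℝ} (hδ : 0 ≤ δ)
    (h : ∀ x, K x → (Measure.infinitePi ν).real {ω | N x ω} ≤ δ) :
    (Measure.infinitePi ν).real {ω | K (g ω) ∧ N (g ω) ω} ≤ δ := by
  classical
  have := Fintype.ofFinite κ
  have hsum : ∑ x : κ, (Measure.infinitePi ν).real {ω | g ω = x} = 1 := by
    rw [← measureReal_biUnion_finset]
    · rw [← probReal_univ (μ := Measure.infinitePi ν)]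
      congr 1
      ext ω
      simp
    · intro x _ y _ hxy
      exact Set.disjoint_left.2 fun ω hx hy => hxy (hx.symm.trans hy)
    · exact fun x _ => (Set.toFinite _).measurableSet
  calc (Measure.infinitePi ν).real {ω | K (g ω) ∧ N (g ω) ω}
      ≤ (Measure.infinitePi ν).real (⋃ x ∈ (Finset.univ : Finset κ),
          {ω | g ω = x ∧ K x ∧ N x ω}) := by
        refine measureReal_mono (fun ω hω => ?_) (measure_ne_top _ _)
        simpa using hω
    _ ≤ ∑ x : κ, (Measure.infinitePi ν).real {ω | g ω = x ∧ K x ∧ N x ω} :=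
        measureReal_biUnion_finset_le _ _
    _ ≤ ∑ x : κ, (Measure.infinitePi ν).real {ω | g ω = x} * δ := by
        refine Finset.sum_le_sum fun x _ => ?_
        by_cases hK : K x
        · simp only [hK, true_and]
          rw [infinitePi_real_and_of_dependsOn (A := fun ω => g ω = x) hST
            (fun a b hab => congrArg (· = x) (hg hab)) (hN x hK)]
          exact mul_le_mul_of_nonneg_left (h x hK) measureReal_nonneg
        · simp only [hK, false_and, and_false]
          simpa using mul_nonneg measureReal_nonneg hδ
    _ = δ := by rw [← Finset.sum_mul, hsum, one_mul]

end Independence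

/-! ### Link paths in the Erdős–Rényi graph -/

section EdgeLaw

variable {V : Type*}

/-- The law of the edge indicators of `G(V, p)`. -/
noncomputable def edgeLaw (V : Type*) (p : I) : Measure (Sym2 V → Prop) :=
  Measure.infinitePi fun e : Sym2 V => unitInterval.toNNReal p • Measure.dirac (¬ e.IsDiag) +
    unitInterval.toNNReal (σ p) • Measure.dirac False

instance (p : I) : IsProbabilityMeasure (edgeLaw V p) := by
  unfold edgeLaw
  infer_instance

theorem edgeLaw_real_edge (p : I) {e : Sym2 V} (he : ¬ e.IsDiag) :
    (edgeLaw V p).real {ω | ω e} = p := by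
  have h := (measurePreserving_eval_infinitePi (fun e : Sym2 V =>
    unitInterval.toNNReal p • Measure.dirac (¬ e.IsDiag) +
    unitInterval.toNNReal (σ p) • Measure.dirac False) e).measureReal_preimage
      (s := {True}) (measurableSet_singleton _).nullMeasurableSet
  have h2 : (Function.eval e ⁻¹' {True} : Set (Sym2 V → Prop)) = {ω | ω e} := by
    ext ω
    simp
  rw [h2] at h
  rw [edgeLaw, h]
  simp [he, measureReal_def]

variable [Finite V]

theorem edgeLaw_real_not_edge (p : I) {e : Sym2 V} (he : ¬ e.IsDiag) :
    (edgeLaw V p).real {ω | ¬ ω e} = 1 - p := by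
  have h := probReal_compl_eq_one_sub (μ := edgeLaw V p) (s := {ω | ω e})
    (Set.toFinite _).measurableSet
  rw [edgeLaw_real_edge p he] at h
  exact h

theorem edgeLaw_real_not_two_edges (p : I) {e f : Sym2 V} (he : ¬ e.IsDiag) (hf : ¬ f.IsDiag)
    (hef : e ≠ f) : (edgeLaw V p).real {ω | ¬ (ω e ∧ ω f)} = 1 - (p : ℝ) ^ 2 := by
  have h := probReal_compl_eq_one_sub (μ := edgeLaw V p) (s := {ω | ω e ∧ ω f})
    (Set.toFinite _).measurableSet
  have h2 : (edgeLaw V p).real {ω | ω e ∧ ω f} =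
      (edgeLaw V p).real {ω | ω e} * (edgeLaw V p).real {ω | ω f} :=
    infinitePi_real_and_of_dependsOn (S := {e}) (T := {f}) (by simpa using hef)
      (fun x y hxy => by simp [hxy e rfl]) (fun x y hxy => by simp [hxy f rfl])
  rw [h2, edgeLaw_real_edge p he, edgeLaw_real_edge p hf, ← sq] at h
  exact h

theorem binomialRandom_real_le_edgeLaw (p : I) {S : Set (SimpleGraph V)}
    {B : Set (Sym2 V → Prop)} (h : ∀ G ∈ S, (fun e => e ∈ G.edgeSet) ∈ B) :
    (SimpleGraph.binomialRandom V p).real S ≤ (edgeLaw V p).real B := by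
  rw [measureReal_def, SimpleGraph.binomialRandom_apply]
  refine ENNReal.toReal_mono (measure_ne_top (edgeLaw V p) B)
    (measure_mono (μ := edgeLaw V p) ?_)
  rintro _ ⟨G, hG, rfl⟩
  exact h G hG

open scoped Classical in
/-- Common neighbours in `U` of `v` and `u`. -/
noncomputable def commonNbrs (U : Finset V) (v u : V) (ω : Sym2 V → Prop) : Finset V :=
  U.filter fun x => ω s(v, x) ∧ ω s(u, x)

theorem edgeLaw_real_commonNbrs_eq_empty (p : I) {v u : V} (huv : v ≠ u) {U : Finset V}
    (hv : v ∉ U) (hu : u ∉ U) :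
    (edgeLaw V p).real {ω | ∀ x ∈ U, ¬ (ω s(v, x) ∧ ω s(u, x))} = (1 - (p : ℝ) ^ 2) ^ U.card := by
  classical
  rw [edgeLaw, infinitePi_real_forall_of_dependsOn
    (A := fun x ω => ¬ (ω s(v, x) ∧ ω s(u, x))) (S := fun x => {s(v, x), s(u, x)})]
  · rw [← Finset.prod_const]
    refine Finset.prod_congr rfl fun x hx => ?_
    have hxv : v ≠ x := fun h => hv (h ▸ hx)
    have hxu : u ≠ x := fun h => hu (h ▸ hx)
    exact edgeLaw_real_not_two_edges p (by simpa using hxv) (by simpa using hxu) (by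
      simp only [ne_eq, Sym2.eq_iff]
      grind)
  · intro x hx y hy hxy
    simp only [Function.onFun, Set.disjoint_left, Set.mem_insert_iff, Set.mem_singleton_iff]
    intro e he he'
    simp only [Finset.mem_coe] at hx hy
    rcases he with rfl | rfl <;> rcases he' with h | h <;> rw [Sym2.eq_iff] at h <;> grind
  · intro x _ a b hab
    simp [hab s(v, x) (by simp), hab s(u, x) (by simp)]

/-- Split `U` into `k` blocks of size `b`: if each block contains a common neighbour there are at
least `k`. The union bound over empty blocks replaces a Chernoff estimate. -/
theorem edgeLaw_real_card_commonNbrs_lt (p : I) {v u : V} (huv : v ≠ u) (b : ℕ) (k : ℕ) :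
    ∀ {U : Finset V}, v ∉ U → u ∉ U → k * b ≤ U.card →
    (edgeLaw V p).real {ω | (commonNbrs U v u ω).card < k} ≤ k * (1 - (p : ℝ) ^ 2) ^ b := by
  classical
  induction k with
  | zero => simp
  | succ k ih =>
    intro U hv hu hU
    obtain ⟨U₁, hU₁, hcard⟩ := Finset.exists_subset_card_eq (n := b) (s := U) (by nlinarith)
    have hU₂ : k * b ≤ (U \ U₁).card := by
      rw [Finset.card_sdiff_of_subset hU₁, hcard]
      have : (k + 1) * b = k * b + b := by ring
      omega
    have h₁ := edgeLaw_real_commonNbrs_eq_empty p huv (fun h => hv (hU₁ h)) (fun h => hu (hU₁ h))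
    rw [hcard] at h₁
    have h₂ := ih (U := U \ U₁) (fun h => hv (Finset.mem_sdiff.1 h).1)
      (fun h => hu (Finset.mem_sdiff.1 h).1) hU₂
    calc (edgeLaw V p).real {ω | (commonNbrs U v u ω).card < k + 1}
        ≤ (edgeLaw V p).real ({ω | (commonNbrs (U \ U₁) v u ω).card < k} ∪
            {ω | ∀ x ∈ U₁, ¬ (ω s(v, x) ∧ ω s(u, x))}) := by
          refine measureReal_mono fun ω hω => ?_
          by_contra hcon
          simp only [Set.mem_union, Set.mem_ofPred_eq, not_or, not_lt, not_forall, not_not] at hcon hω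
          obtain ⟨hk, x, hx, hvx, hux⟩ := hcon
          have hx' : x ∉ commonNbrs (U \ U₁) v u ω := by simp [commonNbrs, hx]
          have hsub : insert x (commonNbrs (U \ U₁) v u ω) ⊆ commonNbrs U v u ω := by
            intro y hy
            simp only [commonNbrs, Finset.mem_insert, Finset.mem_filter, Finset.mem_sdiff] at hy ⊢
            rcases hy with rfl | hy
            · exact ⟨hU₁ hx, hvx, hux⟩
            · exact ⟨hy.1.1, hy.2⟩
          have := Finset.card_le_card hsub
          rw [Finset.card_insert_of_notMem hx'] at this
          omega
      _ ≤ _ := measureReal_union_le _ _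
      _ ≤ k * (1 - (p : ℝ) ^ 2) ^ b + (1 - (p : ℝ) ^ 2) ^ b := by rw [h₁]; gcongr
      _ = _ := by push_cast; ring

theorem edgeLaw_real_no_edges (p : I) {S T : Finset V} (hST : Disjoint S T) :
    (edgeLaw V p).real {ω | ∀ z ∈ S ×ˢ T, ¬ ω s(z.1, z.2)} = (1 - (p : ℝ)) ^ (S.card * T.card) := by
  classical
  have hne : ∀ x ∈ S, ∀ y ∈ T, x ≠ y := fun x hx y hy h => Finset.disjoint_left.1 hST hx (h ▸ hy)
  rw [edgeLaw, infinitePi_real_forall_of_dependsOn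
    (A := fun (z : V × V) ω => ¬ ω s(z.1, z.2)) (S := fun z => {s(z.1, z.2)})]
  · rw [← Finset.card_product, ← Finset.prod_const]
    refine Finset.prod_congr rfl fun z hz => edgeLaw_real_not_edge p ?_
    rw [Finset.mem_product] at hz
    simpa using hne _ hz.1 _ hz.2
  · rintro ⟨x, y⟩ hz ⟨x', y'⟩ hz' hzz'
    simp only [Finset.coe_product, Set.mem_prod, Finset.mem_coe] at hz hz'
    simp only [Function.onFun, Set.disjoint_singleton, ne_eq, Sym2.eq_iff]
    grind
  · intro z _ a b hab
    simp [hab s(z.1, z.2) rfl]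

/-- The failure event of the link condition of `HasLinkPaths` at a triple. -/
theorem edgeLaw_real_no_link_path (p : I) {v u w : V} (hvu : v ≠ u) (hvw : v ≠ w)
    {b k : ℕ} (hcard : 2 * k * b + 3 ≤ Nat.card V) :
    (edgeLaw V p).real {ω | ¬ ∃ x y, ω s(v, x) ∧ ω s(u, x) ∧ ω s(v, y) ∧ ω s(w, y) ∧ ω s(x, y)} ≤
      2 * k * (1 - (p : ℝ) ^ 2) ^ b + (1 - (p : ℝ)) ^ (k * k) := by
  classical
  have := Fintype.ofFinite V
  have hp0 : (0 : ℝ) ≤ 1 - p := sub_nonneg.2 p.2.2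
  have hp1 : 1 - (p : ℝ) ≤ 1 := by linarith [p.2.1]
  let R : Finset V := Finset.univ \ {v, u, w}
  have hR : 2 * k * b ≤ R.card := by
    have h3 : ({v, u, w} : Finset V).card ≤ 3 := Finset.card_le_three
    rw [Finset.card_sdiff_of_subset (Finset.subset_univ _), Finset.card_univ,
      ← Nat.card_eq_fintype_card]
    omega
  obtain ⟨U, hUR, hU⟩ := Finset.exists_subset_card_eq (n := k * b) (s := R) (by nlinarith)
  have hW : k * b ≤ (R \ U).card := by
    rw [Finset.card_sdiff_of_subset hUR, hU]
    have : 2 * k * b = k * b + k * b := by ring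
    omega
  set W := R \ U with hWdef
  have hUW : Disjoint U W := Finset.disjoint_sdiff
  have hU' : ∀ x ∈ U, x ≠ v ∧ x ≠ u ∧ x ≠ w := fun x hx => by simpa [R] using hUR hx
  have hW' : ∀ x ∈ W, x ≠ v ∧ x ≠ u ∧ x ≠ w := fun x hx => by
    simpa [R] using (Finset.mem_sdiff.1 hx).1
  have h1 := edgeLaw_real_card_commonNbrs_lt p hvu b k (U := U)
    (fun h => (hU' v h).1 rfl) (fun h => (hU' u h).2.1 rfl) hU.ge
  have h2 := edgeLaw_real_card_commonNbrs_lt p hvw b k (U := W)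
    (fun h => (hW' v h).1 rfl) (fun h => (hW' w h).2.2 rfl) hW
  let g : (Sym2 V → Prop) → Finset V × Finset V := fun ω => (commonNbrs U v u ω, commonNbrs W v w ω)
  let K : Finset V × Finset V → Prop := fun z =>
    z.1 ⊆ U ∧ z.2 ⊆ W ∧ k ≤ z.1.card ∧ k ≤ z.2.card
  let N : Finset V × Finset V → (Sym2 V → Prop) → Prop :=
    fun z ω => ∀ xy ∈ z.1 ×ˢ z.2, ¬ ω s(xy.1, xy.2)
  -- `g` reads only edges meeting `{v, u, w}`, while edges between `U` and `W` avoid these vertices.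
  have h3 : (edgeLaw V p).real {ω | K (g ω) ∧ N (g ω) ω} ≤ (1 - (p : ℝ)) ^ (k * k) := by
    refine infinitePi_real_le_of_dependsOn (S := {e | v ∈ e ∨ u ∈ e ∨ w ∈ e})
      (T := {e | v ∈ e ∨ u ∈ e ∨ w ∈ e}ᶜ) disjoint_compl_right ?_ ?_ (by positivity) ?_
    · intro a c hac
      simp only [g, commonNbrs]
      congr 1 <;> refine Finset.filter_congr fun x _ => ?_
      · rw [hac s(v, x) (by simp), hac s(u, x) (by simp)]
      · rw [hac s(v, x) (by simp), hac s(w, x) (by simp)]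
    · rintro ⟨A, B⟩ ⟨hA, hB, -, -⟩ a c hac
      refine propext (forall₂_congr fun z hz => ?_)
      rw [Finset.mem_product] at hz
      have hz1 := hU' _ (hA hz.1)
      have hz2 := hW' _ (hB hz.2)
      rw [hac s(z.1, z.2) (by
        simp only [Set.mem_compl_iff, Set.mem_ofPred_eq, Sym2.mem_iff]
        grind)]
    · rintro ⟨A, B⟩ ⟨hA, hB, hkA, hkB⟩
      have h := edgeLaw_real_no_edges p
        (Finset.disjoint_of_subset_left hA (Finset.disjoint_of_subset_right hB hUW))
      exact h.le.trans (pow_le_pow_of_le_one hp0 hp1 (Nat.mul_le_mul hkA hkB))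
  calc _ ≤ (edgeLaw V p).real (({ω | (commonNbrs U v u ω).card < k} ∪
        {ω | (commonNbrs W v w ω).card < k}) ∪ {ω | K (g ω) ∧ N (g ω) ω}) := by
        refine measureReal_mono fun ω hω => ?_
        by_contra hcon
        simp only [Set.mem_union, Set.mem_ofPred_eq, not_or, not_lt] at hcon hω
        refine hcon.2 ⟨⟨Finset.filter_subset _ _, Finset.filter_subset _ _, hcon.1.1, hcon.1.2⟩, ?_⟩
        intro z hz hzω
        simp only [g, commonNbrs, Finset.mem_product, Finset.mem_filter] at hz
        exact hω ⟨z.1, z.2, hz.1.2.1, hz.1.2.2, hz.2.2.1, hz.2.2.2, hzω⟩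
    _ ≤ _ := measureReal_union_le _ _
    _ ≤ _ := by
        have := measureReal_union_le (μ := edgeLaw V p) {ω | (commonNbrs U v u ω).card < k}
          {ω | (commonNbrs W v w ω).card < k}
        linarith

theorem binomialRandom_real_not_hasLinkPaths (p : I) {b k : ℕ}
    (hcard : 2 * k * b + 3 ≤ Nat.card V) :
    (SimpleGraph.binomialRandom V p).real {G | ¬ HasLinkPaths G} ≤
      (Nat.card V : ℝ) ^ 3 * (2 * k * (1 - (p : ℝ) ^ 2) ^ b + (1 - (p : ℝ)) ^ (k * k)) := by
  classical
  have := Fintype.ofFinite V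
  have hp0 : (0 : ℝ) ≤ 1 - p := sub_nonneg.2 p.2.2
  have hp2 : (0 : ℝ) ≤ 1 - (p : ℝ) ^ 2 := by nlinarith [p.2.1]
  -- The inequalities are part of the event, so degenerate triples contribute the empty set.
  let F : V × V × V → Set (Sym2 V → Prop) := fun z => {ω | z.1 ≠ z.2.1 ∧ z.1 ≠ z.2.2 ∧
    ¬ ∃ x y, ω s(z.1, x) ∧ ω s(z.2.1, x) ∧ ω s(z.1, y) ∧ ω s(z.2.2, y) ∧ ω s(x, y)}
  calc _ ≤ (edgeLaw V p).real (⋃ z ∈ (Finset.univ : Finset (V × V × V)), F z) := by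
        refine binomialRandom_real_le_edgeLaw p fun G hG => ?_
        simp only [Set.mem_ofPred_eq, HasLinkPaths, not_forall] at hG
        obtain ⟨v, u, w, hvu, hvw, -, h⟩ := hG
        simp only [Set.mem_iUnion]
        exact ⟨(v, u, w), Finset.mem_univ _, hvu, hvw, h⟩
    _ ≤ ∑ z : V × V × V, (edgeLaw V p).real (F z) := measureReal_biUnion_finset_le _ _
    _ ≤ ∑ z : V × V × V, (2 * k * (1 - (p : ℝ) ^ 2) ^ b + (1 - (p : ℝ)) ^ (k * k)) := by
        refine Finset.sum_le_sum fun z _ => ?_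
        by_cases hz : z.1 ≠ z.2.1 ∧ z.1 ≠ z.2.2
        · exact (measureReal_mono fun ω hω => hω.2.2).trans
            (edgeLaw_real_no_link_path p hz.1 hz.2 hcard)
        · have : F z = ∅ := by
            ext ω
            simp only [F, Set.mem_ofPred_eq, Set.mem_empty_iff_false, iff_false]
            tauto
          rw [this, measureReal_empty]
          positivity
    _ = _ := by
        simp only [Finset.sum_const, Finset.card_univ, Fintype.card_prod, nsmul_eq_mul,
          Nat.card_eq_fintype_card]
        push_cast
        ring

end EdgeLaw

/-! ### Choice of parameters and asymptotics -/

theorem one_sub_pow_le_exp {x : ℝ} (hx : x ≤ 1) {k : ℕ} {c : ℝ} (h : c ≤ x * k) :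
    (1 - x) ^ k ≤ Real.exp (-c) := by
  calc (1 - x) ^ k ≤ Real.exp (-x) ^ k :=
        pow_le_pow_left₀ (by linarith) (Real.one_sub_le_exp_neg x) k
    _ = Real.exp (-(x * k)) := by rw [← Real.exp_nat_mul]; congr 1; ring
    _ ≤ _ := Real.exp_le_exp.2 (by linarith)

/-- Half of the exponent `m / 8` absorbs a polynomial of degree `29`. The threshold `20` serves the
later estimate `m + 1 ≤ 21 / 20 * m`. -/
theorem eventually_cube_bound :
    ∃ M : ℕ, 20 ≤ M ∧ ∀ m : ℕ, M ≤ m →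
      (((m : ℝ) + 1) ^ 9) ^ 3 * (3 * (m : ℝ) ^ 2 * Real.exp (-(m / 8))) ≤ Real.exp (-(m / 16)) := by
  have h := (isLittleO_pow_exp_pos_mul_atTop 29 (b := 1 / 16) (by norm_num)).bound
    (c := 1 / (3 * 2 ^ 27)) (by norm_num)
  obtain ⟨X, hX⟩ := Filter.eventually_atTop.1 h
  refine ⟨max 20 ⌈X⌉₊, le_max_left _ _, fun m hm => ?_⟩
  have h1 := hX m ((Nat.le_ceil X).trans (by exact_mod_cast (le_max_right _ _).trans hm))
  have hm1 : (1 : ℝ) ≤ m := by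
    exact_mod_cast le_trans (by norm_num) ((le_max_left 20 ⌈X⌉₊).trans hm)
  rw [Real.norm_of_nonneg (by positivity), Real.norm_of_nonneg (by positivity)] at h1
  have h2 : Real.exp (-((m : ℝ) / 8)) = Real.exp (-(m / 16)) * Real.exp (-(m / 16)) := by
    rw [← Real.exp_add]
    ring_nf
  have h3 : Real.exp (1 / 16 * (m : ℝ)) * Real.exp (-(m / 16)) = 1 := by
    rw [← Real.exp_add, Real.exp_eq_one_iff]
    ring
  have h4 : (((m : ℝ) + 1) ^ 9) ^ 3 ≤ 2 ^ 27 * (m : ℝ) ^ 27 := by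
    rw [← pow_mul, ← mul_pow]
    gcongr
    linarith
  calc (((m : ℝ) + 1) ^ 9) ^ 3 * (3 * (m : ℝ) ^ 2 * Real.exp (-(m / 8)))
      ≤ (2 ^ 27 * (m : ℝ) ^ 27) * (3 * (m : ℝ) ^ 2 * Real.exp (-(m / 8))) := by gcongr
    _ = (3 * 2 ^ 27) * (m : ℝ) ^ 29 * Real.exp (-(m / 16)) * Real.exp (-(m / 16)) := by
        rw [h2]
        ring
    _ ≤ Real.exp (1 / 16 * (m : ℝ)) * Real.exp (-(m / 16)) * Real.exp (-(m / 16)) := by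
        gcongr
        linarith
    _ = _ := by rw [h3, one_mul]

/-- At edge probability `n ^ (-1/3)`, the parameters of `binomialRandom_real_not_hasLinkPaths` can be
chosen such that the failure probability is stretched-exponentially small. -/
theorem exists_link_parameters : ∃ n₀ : ℕ, 3 ≤ n₀ ∧ ∀ n : ℕ, n₀ ≤ n → ∀ p : ℝ,
    (n : ℝ) ^ (-(1 / 3) : ℝ) ≤ p → p ≤ 1 → ∃ b k : ℕ, 2 * k * b + 3 ≤ n ∧
      (n : ℝ) ^ 3 * (2 * k * (1 - p ^ 2) ^ b + (1 - p) ^ (k * k)) ≤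
        Real.exp (-(1 / 32 * (n : ℝ) ^ (1 / 9 : ℝ))) := by
  obtain ⟨M, hM, hbound⟩ := eventually_cube_bound
  refine ⟨M ^ 9, le_trans (by norm_num) (Nat.pow_le_pow_left hM 9), fun n hn p hp hp1 => ?_⟩
  set x : ℝ := (n : ℝ) ^ (1 / 9 : ℝ) with hx
  have hx0 : 0 ≤ x := by positivity
  have hn0 : (0 : ℝ) ≤ n := n.cast_nonneg
  have hx9 : x ^ 9 = n := by
    rw [hx, ← Real.rpow_natCast, ← Real.rpow_mul hn0]
    norm_num
  have hx3 : (n : ℝ) ^ (-(1 / 3) : ℝ) = (x ^ 3)⁻¹ := by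
    rw [Real.rpow_neg hn0, hx, ← Real.rpow_natCast, ← Real.rpow_mul hn0]
    norm_num
  have hMx : (M : ℝ) ≤ x := by
    refine le_of_pow_le_pow_left₀ (n := 9) (by norm_num) hx0 ?_
    rw [hx9]
    exact_mod_cast hn
  set m := ⌊x⌋₊ with hm
  have hMm : M ≤ m := Nat.le_floor hMx
  have hmx : (m : ℝ) ≤ x := Nat.floor_le hx0
  have hxm : x < m + 1 := Nat.lt_floor_add_one x
  have hm20 : (20 : ℝ) ≤ m := by exact_mod_cast hM.trans hMm
  have hmn : m ^ 9 ≤ n := by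
    have : (m : ℝ) ^ 9 ≤ x ^ 9 := by gcongr
    rw [hx9] at this
    exact_mod_cast this
  have hx_pos : 0 < x := by linarith
  have hmp : (((m : ℝ) + 1) ^ 3)⁻¹ ≤ p := by
    refine le_trans ?_ (hx3 ▸ hp)
    gcongr
  have hp0 : 0 < p := lt_of_lt_of_le (by positivity) hmp
  have hp2 : (((m : ℝ) + 1) ^ 6)⁻¹ ≤ p ^ 2 := by
    calc (((m : ℝ) + 1) ^ 6)⁻¹ = ((((m : ℝ) + 1) ^ 3)⁻¹) ^ 2 := by rw [inv_pow, ← pow_mul]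
      _ ≤ p ^ 2 := by gcongr
  have hsucc : (m : ℝ) + 1 ≤ 21 / 20 * m := by linarith
  have hb : (m : ℝ) / 8 ≤ p ^ 2 * (m ^ 7 / 4 : ℕ) := by
    have h1 : (m : ℝ) ^ 7 / 4 - 1 ≤ (m ^ 7 / 4 : ℕ) := by
      have : m ^ 7 < 4 * (m ^ 7 / 4) + 4 := by omega
      have : (m : ℝ) ^ 7 < 4 * (m ^ 7 / 4 : ℕ) + 4 := by exact_mod_cast this
      linarith
    have h2 : ((m : ℝ) + 1) ^ 6 ≤ 3 / 2 * (m : ℝ) ^ 6 := by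
      calc ((m : ℝ) + 1) ^ 6 ≤ (21 / 20 * m) ^ 6 := by gcongr
        _ = (21 / 20) ^ 6 * (m : ℝ) ^ 6 := by ring
        _ ≤ _ := by gcongr; norm_num
    have h3 : (20 : ℝ) ^ 7 ≤ (m : ℝ) ^ 7 := by gcongr
    have h4 : (m : ℝ) / 8 * ((m : ℝ) + 1) ^ 6 ≤ (m ^ 7 / 4 : ℕ) := by
      calc (m : ℝ) / 8 * ((m : ℝ) + 1) ^ 6 ≤ (m : ℝ) / 8 * (3 / 2 * (m : ℝ) ^ 6) := by gcongr
        _ = 3 / 16 * (m : ℝ) ^ 7 := by ring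
        _ ≤ (m : ℝ) ^ 7 / 4 - 1 := by linarith
        _ ≤ _ := h1
    calc (m : ℝ) / 8 = (((m : ℝ) + 1) ^ 6)⁻¹ * (m / 8 * ((m : ℝ) + 1) ^ 6) := by field_simp
      _ ≤ p ^ 2 * (m ^ 7 / 4 : ℕ) := by gcongr
  have hk : (m : ℝ) / 8 ≤ p * (m ^ 2 * m ^ 2 : ℕ) := by
    have h2 : ((m : ℝ) + 1) ^ 3 ≤ 8 * (m : ℝ) ^ 3 := by
      calc ((m : ℝ) + 1) ^ 3 ≤ (2 * m) ^ 3 := by gcongr; linarith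
        _ = _ := by ring
    calc (m : ℝ) / 8 = (((m : ℝ) + 1) ^ 3)⁻¹ * (m / 8 * ((m : ℝ) + 1) ^ 3) := by field_simp
      _ ≤ p * (m / 8 * (8 * (m : ℝ) ^ 3)) := by gcongr
      _ = _ := by push_cast; ring
  -- With `n ≈ m ^ 9` and `p ≳ m ^ (-3)`, the choices `b ≈ m ^ 7 / 4` and `k = m ^ 2` fit into `n`
  -- vertices and make both `p ^ 2 * b` and `p * k ^ 2` at least `m / 8`.
  refine ⟨m ^ 7 / 4, m ^ 2, ?_, ?_⟩
  · have h1 : 4 * (m ^ 7 / 4) ≤ m ^ 7 := Nat.mul_div_le _ _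
    have h2 : 4 * (m ^ 2 * (m ^ 7 / 4)) ≤ m ^ 9 := by
      calc 4 * (m ^ 2 * (m ^ 7 / 4)) = m ^ 2 * (4 * (m ^ 7 / 4)) := by ring
        _ ≤ m ^ 2 * m ^ 7 := Nat.mul_le_mul_left _ h1
        _ = m ^ 9 := by ring
    have h3 : 20 ^ 9 ≤ m ^ 9 := Nat.pow_le_pow_left (hM.trans hMm) 9
    rw [mul_assoc]
    omega
  · have e1 := one_sub_pow_le_exp (by nlinarith) hb
    have e2 := one_sub_pow_le_exp hp1 hk
    have h1m : (1 : ℝ) ≤ (m : ℝ) ^ 2 := one_le_pow₀ (by linarith)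
    have hp2' : 0 ≤ 1 - p ^ 2 := by nlinarith
    have hp' : 0 ≤ 1 - p := by linarith
    calc (n : ℝ) ^ 3 * (2 * (m ^ 2 : ℕ) * (1 - p ^ 2) ^ (m ^ 7 / 4) + (1 - p) ^ (m ^ 2 * m ^ 2))
        ≤ (((m : ℝ) + 1) ^ 9) ^ 3 * (2 * (m ^ 2 : ℕ) * Real.exp (-(m / 8)) +
            (m : ℝ) ^ 2 * Real.exp (-(m / 8))) := by
          rw [← hx9]
          gcongr
          exact e2.trans (le_mul_of_one_le_left (Real.exp_nonneg _) h1m)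
      _ = (((m : ℝ) + 1) ^ 9) ^ 3 * (3 * (m : ℝ) ^ 2 * Real.exp (-(m / 8))) := by
          push_cast
          ring
      _ ≤ Real.exp (-(m / 16)) := hbound m hMm
      -- The floor costs a factor of two at most: `x < m + 1 ≤ 2 * m`.
      _ ≤ _ := Real.exp_le_exp.2 (by linarith)

/-! ### Combining graph and locations -/

theorem IsHLVModel.measureReal_not_isParallelRigid_le {Ω : Type*} [MeasurableSpace Ω]
    {P : Measure Ω} [IsProbabilityMeasure P] {n : ℕ} (hn : 3 ≤ n) {p : I} {εb : ℝ}
    {t : Fin n → Ω → E3} {G B : Ω → SimpleGraph (Fin n)} {γ : Ω → Fin n → Fin n → E3}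
    (h : IsHLVModel P n p εb t G B γ) :
    P.real {ω | ¬ IsParallelRigid (G ω) fun i => t i ω} ≤
      (SimpleGraph.binomialRandom (Fin n) p).real {H | ¬ HasLinkPaths H} := by
  have hm : MeasurableSet {H : SimpleGraph (Fin n) | ¬ HasLinkPaths H} := by
    have : MeasurableSet (SimpleGraph.edgeSet '' {H : SimpleGraph (Fin n) | ¬ HasLinkPaths H}) :=
      (Set.toFinite _).measurableSet
    exact SimpleGraph.measurableEmbedding_edgeSet.measurableSet_image.1 this
  rw [← h.graph_law.measureReal_eq hm]
  refine ENNReal.toReal_mono (measure_ne_top _ _) (measure_mono_ae ?_)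
  filter_upwards [ae_inGeneralPosition h.location_law h.location_indep] with ω hω hrigid hG
  exact hrigid (hG.isParallelRigid hn hω)

theorem propositionA1 :
    ∃ α : ℝ, 0 < α ∧ ∃ C : ℝ, 0 < C ∧
      ∀ C₀ : ℝ, 0 < C₀ → ∀ C₁ : ℝ, 0 < C₁ → ∃ n₀ : ℕ,
        ∀ n : ℕ, n₀ < n → ∀ (p : unitInterval) (εb : ℝ),
          C₀ * (n : ℝ) ^ (-(1 / 3) : ℝ) * (Real.log n) ^ (1 / 3 : ℝ) ≤ (p : ℝ) →
          εb ≤ C₁ * (p : ℝ) ^ (7 / 3 : ℝ) / (Real.log n) ^ (9 / 2 : ℝ) →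
          ∀ (Ω : Type*) [MeasurableSpace Ω] (P : Measure Ω) [IsProbabilityMeasure P]
            (t : Fin n → Ω → E3) (G B : Ω → SimpleGraph (Fin n)) (γ : Ω → Fin n → Fin n → E3),
            IsHLVModel P n p εb t G B γ →
              ∃ A : Set Ω, MeasurableSet A ∧
                1 - Real.exp (-(C * (n : ℝ) ^ α)) ≤ P.real A ∧
                ∀ ω ∈ A, IsParallelRigid (G ω) (fun i => t i ω) := by

  obtain ⟨n₀, hn₀, hparam⟩ := exists_link_parameters
  refine ⟨1 / 9, by norm_num, 1 / 32, by norm_num, fun C₀ hC₀ C₁ _ => ?_⟩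
  -- The logarithmic factor eventually exceeds `1 / C₀`, leaving `p ≥ n ^ (-1/3)` whatever the
  -- constant.
  have hlog : Filter.Tendsto (fun n : ℕ => C₀ * Real.log n ^ (1 / 3 : ℝ)) Filter.atTop
      Filter.atTop :=
    ((tendsto_rpow_atTop (by norm_num)).comp
      (Real.tendsto_log_atTop.comp tendsto_natCast_atTop_atTop)).const_mul_atTop hC₀
  obtain ⟨n₁, hn₁⟩ := Filter.eventually_atTop.1 (hlog.eventually_ge_atTop 1)
  refine ⟨max n₀ n₁, fun n hn p εb hp _ Ω _ P _ t G B γ h => ?_⟩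
  obtain ⟨hn0, hn1⟩ := max_lt_iff.1 hn
  have hp' : (n : ℝ) ^ (-(1 / 3) : ℝ) ≤ p := by
    refine le_trans ?_ hp
    rw [mul_right_comm]
    exact le_mul_of_one_le_left (by positivity) (hn₁ n hn1.le)
  obtain ⟨b, k, hcard, hbound⟩ := hparam n hn0.le p hp' p.2.2
  have hle := (h.measureReal_not_isParallelRigid_le (hn₀.trans hn0.le)).trans
    (binomialRandom_real_not_hasLinkPaths p (by simpa using hcard))
  rw [Nat.card_fin] at hle
  set bad : Set Ω := {ω | ¬ IsParallelRigid (G ω) fun i => t i ω} with hbad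
  -- The bad event is not known to be measurable; its measurable hull has the same measure.
  refine ⟨(toMeasurable P bad)ᶜ, (measurableSet_toMeasurable _ _).compl, ?_, fun ω hω => ?_⟩
  · rw [probReal_compl_eq_one_sub (measurableSet_toMeasurable _ _), measureReal_def,
      measure_toMeasurable, ← measureReal_def]
    linarith
  · by_contra hcon
    exact hω (subset_toMeasurable P bad hcon)
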